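/- Consider single-item auctions with $n$ buyers, and write $\mathbb{R}_+=[0,\infty)$. Let $\mathcal{F}_1,\dots,\mathcal{F}_n$ be classes of probability distributions on $\mathbb{R}_+$, each containing all distributions of finite mean (in particular, each $\mathcal F_i$ may be the class of all distributions on $\mathbb{R}_+$), and let $\boldsymbol{\mathcal F}=\mathcal F_1\times\cdots\times\mathcal F_n$. A *distribution-reporting mechanism* $M=(x,p)$ consists of allocation rules $x_i:\mathbb{R}_+^n\times\boldsymbol{\mathcal F}\to[0,1]$ and payment rules $p_i:\boldsymbol{\mathcal F}\to\mathbb{R}$, $i\in[n]$; here $x_i(\boldsymbol b;\boldsymbol B)$ is the probability that buyer $i$ gets the item when the reported distributions are $\boldsymbol B$ and the bids are $\boldsymbol b$. If the reports are $\boldsymbol B$ and buyer $i$ has the true value distribution $F_i$, her ex-ante utility is $$U_i^M(\boldsymbol B;F_i)=\mathbb{E}_{q\sim U[0,1],\ \boldsymbol b_{-i}\sim\boldsymbol B_{-i}}\big[x_i(b_i(q),\boldsymbol b_{-i};\boldsymbol B)\,v_i(q)\big]-p_i(\boldsymbol B)\in(-\infty,\infty],$$ where $v_i(q)=F_i^{-1}(1-q)$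 and $b_i(q)=B_i^{-1}(1-q)$ are the quantile functions of $F_i$ and $B_i$, and $q$ and the bids $b_j\sim B_j$ ($j\ne i$) are independent. The mechanism is *valid* if it is - ex-ante incentive compatible: $U_i^M(F_i,\boldsymbol B_{-i};F_i)\ge U_i^M(B_i,\boldsymbol B_{-i};F_i)$ for all $i$, all $F_i\in\mathcal F_i$ and all $\boldsymbol B\in\boldsymbol{\mathcal F}$; - ex-ante individually rational: $U_i^M(\boldsymbol F;F_i)\ge 0$ for all $\boldsymbol F\in\boldsymbol{\mathcal F}$ and all $i$; and - feasible: $\sum_{i}x_i(\boldsymbol b;\boldsymbol B)\le 1$ for all $\boldsymbol b\in\mathbb{R}_+^n$ and $\boldsymbol B\in\boldsymbol{\mathcal F}$. Its revenue on an instance $\boldsymbol F\in\boldsymbol{\mathcal F}$ is $\mathrm{REV}(M,\boldsymbol F)=\sum_i p_i(\boldsymbol F)$. Let $\mathrm{WEL}(\boldsymbol F)$ and $\mathrm{SPA}(\boldsymbol F)$ be the expectations of the highest and of the second-highest (counted with multiplicity) of independent values $v_i\sim F_i$, $i\in[n]$. **Theorem.** Let $n\ge 2$ be an integer and let $K\ge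 6$ be a real number. For every valid distribution-reporting mechanism $M$ there is an instance $\boldsymbol F\in\boldsymbol{\mathcal F}$ with $\mathrm{SPA}(\boldsymbol F)>0$ and $\mathrm{WEL}(\boldsymbol F)<\infty$ such that $$\mathrm{REV}(M,\boldsymbol F)\le\min\Big\{\frac{64}{K+\log_2 n}\,\mathrm{WEL}(\boldsymbol F),\ 2^K\,\mathrm{SPA}(\boldsymbol F)\Big\}.$$ -/

import Mathlib

noncomputable section

open MeasureTheory
open scoped NNReal ENNReal

namespace DistReport

/-- Distributions on `[0, ∞)`; the class of all distributions is `Set.univ : Set Dist`. -/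
abbrev Dist : Type := ProbabilityMeasure ℝ≥0

/-- The mean of a distribution, as a value in `[0, ∞]`. -/
def mean (D : Dist) : ℝ≥0∞ := ∫⁻ v, (v : ℝ≥0∞) ∂(D : Measure ℝ≥0)

/-- The quantile function `v(q) = F⁻¹(1 - q)`, where `F⁻¹` is the generalized inverse of the
cumulative distribution function. It is used for `q` uniform on `[0, 1]`; at `q = 0` (a null set)
the value is `0` if the distribution has unbounded support. -/
def quantile (D : Dist) (q : ℝ) : ℝ≥0 :=
  sInf {t : ℝ≥0 | 1 - q ≤ (D : Measure ℝ≥0).real (Set.Iic t)}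

/-- Distribution profiles: one member of the class `𝓕 i` for every buyer `i`. -/
abbrev Profile {n : ℕ} (𝓕 : Fin n → Set Dist) : Type := ∀ i, 𝓕 i

/-- The joint law of independent draws, the `i`-th one from the `i`-th distribution. -/
def joint {n : ℕ} {𝓕 : Fin n → Set Dist} (B : Profile 𝓕) : Measure (Fin n → ℝ≥0) :=
  Measure.pi fun i => ((B i : Dist) : Measure ℝ≥0)

/-- A distribution-reporting mechanism for the distribution classes `𝓕`: allocation probabilities
depending on the bids and on the reported distributions (measurable in the bids, so that
expectations make sense), and payments depending on the reported distributions. -/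
structure Mechanism {n : ℕ} (𝓕 : Fin n → Set Dist) where
  alloc : Fin n → (Fin n → ℝ≥0) → Profile 𝓕 → ℝ≥0
  pay : Fin n → Profile 𝓕 → ℝ
  alloc_le_one : ∀ i b B, alloc i b B ≤ 1
  measurable_alloc : ∀ i B, Measurable fun b => alloc i b B

namespace Mechanism

variable {n : ℕ} {𝓕 : Fin n → Set Dist}

/-- `E[x_i(b_i(q), b_{-i}; B) · v_i(q)]` for `q` uniform on `[0, 1]` and independent
`b_{-i} ∼ B_{-i}`, where `b_i(·)` and `v_i(·)` are the quantile functions of the reported `B_i` and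
of the true `D`. The `i`-th coordinate of `b` is overwritten, so only `b_{-i}` matters. -/
def expectedValue (M : Mechanism 𝓕) (i : Fin n) (B : Profile 𝓕) (D : Dist) : ℝ≥0∞ :=
  ∫⁻ q in Set.Icc (0 : ℝ) 1, ∫⁻ b,
    (M.alloc i (Function.update b i (quantile (B i) q)) B : ℝ≥0∞) * (quantile D q : ℝ≥0∞) ∂joint B

/-- The ex-ante utility of buyer `i` with true distribution `D` when the reports are `B`. It is
`⊤` exactly if the expected value obtained is infinite. -/
def utility (M : Mechanism 𝓕) (i : Fin n) (B : Profile 𝓕) (D : Dist) : EReal :=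
  (M.expectedValue i B D : EReal) - (M.pay i B : EReal)

/-- Ex-ante incentive compatibility: whatever the others report, reporting the true distribution
`D` maximizes the ex-ante utility over all reports in the class. -/
def ExAnteIC (M : Mechanism 𝓕) : Prop :=
  ∀ (i : Fin n) (D : 𝓕 i) (B : Profile 𝓕),
    M.utility i B D ≤ M.utility i (Function.update B i D) D

/-- Ex-ante individual rationality. -/
def ExAnteIR (M : Mechanism 𝓕) : Prop :=
  ∀ (F : Profile 𝓕) (i : Fin n), 0 ≤ M.utility i F (F i)

/-- Single-item feasibility. -/
def Feasible (M : Mechanism 𝓕) : Prop :=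
  ∀ (b : Fin n → ℝ≥0) (B : Profile 𝓕), ∑ i, M.alloc i b B ≤ 1

structure Valid (M : Mechanism 𝓕) : Prop where
  exAnteIC : M.ExAnteIC
  exAnteIR : M.ExAnteIR
  feasible : M.Feasible

/-- The expected revenue under truthful reports. -/
def rev (M : Mechanism 𝓕) (F : Profile 𝓕) : ℝ := ∑ i, M.pay i F

end Mechanism

/-- The highest entry of a vector. -/
def highest {n : ℕ} (v : Fin n → ℝ≥0) : ℝ≥0 := Finset.univ.sup v

/-- The second-highest entry of a vector, counted with multiplicity: the largest number that is at
most `v i` and at most `v j` for two distinct indices `i`, `j`. -/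
def secondHighest {n : ℕ} (v : Fin n → ℝ≥0) : ℝ≥0 :=
  (Finset.univ.offDiag : Finset (Fin n × Fin n)).sup fun p => min (v p.1) (v p.2)

/-- The optimal expected social welfare. -/
def WEL {n : ℕ} {𝓕 : Fin n → Set Dist} (F : Profile 𝓕) : ℝ≥0∞ :=
  ∫⁻ v, (highest v : ℝ≥0∞) ∂joint F

/-- The expected revenue of the second-price auction. -/
def SPA {n : ℕ} {𝓕 : Fin n → Set Dist} (F : Profile 𝓕) : ℝ≥0∞ :=
  ∫⁻ v, (secondHighest v : ℝ≥0∞) ∂joint F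

end DistReport

end

/-!
Let the value of every buyer be a scale `2 ^ t i` times a draw from one common distribution of mean
`1`. The quantile functions of the possible reports of a buyer are then proportional, so the
constraints against reporting the next smaller scale only involve the mean `y k ∈ [0, 1]` of the
allocated base value at scale `2 ^ k`. If the exponents `t i` are drawn independently from a
geometric distribution truncated at `m`, these constraints telescope and bound the expected payment
of each buyer by `y m ≤ 1`, hence the expected revenue by `n`.

Now let the base value be `2 * n` with probability `1 / (2 * n)` and `0` otherwise. Each buyer is
the only active one with probability at least `1 / (4 * n)`, so the welfare is at least half the sum
`∑ i, 2 ^ t i`, which has mean `n * (m / 2 + 1)`; two buyers are active with constant probability,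
so the second-price revenue is at least `n / 16`. Taking `m` to be about `(K + log₂ n) / 4` makes
the truncation level small enough for the sum to concentrate, and the bound
`min y c ≥ y - y ^ 2 / (4 * c)` turns its first two moments into a lower bound of `n` on the
expected benchmark. Some choice of the scales therefore satisfies the claim. This needs
`K + log₂ n > 64`; otherwise point masses at `1` suffice, as the revenue is at most the welfare.
-/

noncomputable section

open Filter MeasureTheory ProbabilityTheory Topology
open scoped NNReal ENNReal

namespace DistReport

section Probability

variable {ι : Type*} [Fintype ι]

lemma pi_dirac {X : ι → Type*} [∀ i, MeasurableSpace (X i)] (x : ∀ i, X i) :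
    Measure.pi (fun i ↦ Measure.dirac (x i)) = Measure.dirac x := by
  classical
  refine Measure.pi_eq fun s hs ↦ ?_
  simp only [Measure.dirac_apply' _ (MeasurableSet.univ_pi hs), Measure.dirac_apply' _ (hs _),
    Set.indicator_apply, Set.mem_univ_pi, Pi.one_apply, Finset.prod_ite_zero, Finset.mem_univ,
    forall_const, Finset.prod_const_one]

lemma measurePreserving_update [DecidableEq ι] {X : ι → Type*} [∀ i, MeasurableSpace (X i)]
    (μ : ∀ i, Measure (X i)) [∀ i, SigmaFinite (μ i)] (i : ι) [IsProbabilityMeasure (μ i)] :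
    MeasurePreserving (fun z : (∀ j, X j) × X i ↦ Function.update z.1 i z.2)
      ((Measure.pi μ).prod (μ i)) (Measure.pi μ) := by
  refine ⟨measurable_update', (Measure.pi_eq fun s hs ↦ ?_).symm⟩
  have preimage_eq : (fun z : (∀ j, X j) × X i ↦ Function.update z.1 i z.2) ⁻¹' Set.univ.pi s =
      Set.univ.pi (Function.update s i Set.univ) ×ˢ s i := by
    ext ⟨x, y⟩
    simp only [Set.mem_preimage, Set.mem_univ_pi, Set.mem_prod, Function.forall_update_iff x,
      Function.forall_update_iff s (fun j t ↦ x j ∈ t), Set.mem_univ, true_and]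
    exact and_comm
  rw [Measure.map_apply measurable_update' (.univ_pi hs), preimage_eq, Measure.prod_prod,
    Measure.pi_pi, ← Finset.prod_erase_mul _ _ (Finset.mem_univ i),
    ← Finset.prod_erase_mul _ _ (Finset.mem_univ i), Function.update_self, measure_univ, mul_one]
  congr 1
  exact Finset.prod_congr rfl fun j hj ↦ by rw [Function.update_of_ne (Finset.ne_of_mem_erase hj)]

lemma integral_sum_comp_eval {Ω : Type*} [MeasurableSpace Ω] {μ : Measure Ω}
    [IsProbabilityMeasure μ] {X : Ω → ℝ} (hX : Integrable X μ) :
    ∫ ω : ι → Ω, ∑ i, X (ω i) ∂Measure.pi (fun _ ↦ μ) = Fintype.card ι * ∫ x, X x ∂μ := by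
  rw [integral_finsetSum _ fun i _ ↦ integrable_comp_eval (μ := fun _ ↦ μ) hX]
  simp [integral_comp_eval (μ := fun _ : ι ↦ μ) hX.aestronglyMeasurable]

lemma variance_sum_comp_eval_le {Ω : Type*} [MeasurableSpace Ω] {μ : Measure Ω}
    [IsProbabilityMeasure μ] {X : Ω → ℝ} (hX : MemLp X 2 μ) :
    Var[fun ω : ι → Ω ↦ ∑ i, X (ω i); Measure.pi (fun _ ↦ μ)] ≤
      Fintype.card ι * ∫ x, X x ^ 2 ∂μ := by
  have variance_eq := variance_sum_pi (ι := ι) (μ := fun _ ↦ μ) (X := fun _ ↦ X) fun _ ↦ hX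
  rw [Finset.sum_fn] at variance_eq
  rw [variance_eq, Finset.sum_const, Finset.card_univ, nsmul_eq_mul]
  gcongr
  exact variance_le_expectation_sq hX.aestronglyMeasurable

lemma sub_sq_div_le_min {c : ℝ} (hc : 0 < c) (y : ℝ) : y - y ^ 2 / (4 * c) ≤ min y c := by
  refine le_min (sub_le_self _ (by positivity)) ?_
  rw [sub_le_iff_le_add, ← sub_le_iff_le_add', le_div_iff₀ (by positivity)]
  nlinarith [sq_nonneg (y - 2 * c)]

lemma integral_sub_variance_div_le_integral_min {Ω : Type*} [MeasurableSpace Ω] {μ : Measure Ω}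
    [IsProbabilityMeasure μ] {Y : Ω → ℝ} (hY : MemLp Y 2 μ) {c : ℝ} (hc : 0 < c) :
    μ[Y] - (Var[Y; μ] + μ[Y] ^ 2) / (4 * c) ≤ ∫ ω, min (Y ω) c ∂μ := by
  have hY_int : Integrable Y μ := hY.integrable one_le_two
  calc μ[Y] - (Var[Y; μ] + μ[Y] ^ 2) / (4 * c) = ∫ ω, (Y ω - Y ω ^ 2 / (4 * c)) ∂μ := by
        rw [integral_sub hY_int (hY.integrable_sq.div_const _), integral_div, variance_eq_sub hY,
          sub_add_cancel]
        rfl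
    _ ≤ ∫ ω, min (Y ω) c ∂μ :=
        integral_mono (hY_int.sub (hY.integrable_sq.div_const _))
          (hY_int.inf (integrable_const c)) fun ω ↦ sub_sq_div_le_min hc (Y ω)

end Probability

section Quantile

variable {D : Dist} {q : ℝ}

lemma one_sub_le_real_Iic_quantile (D : Dist) (hq : 0 < q) :
    1 - q ≤ (D : Measure ℝ≥0).real (Set.Iic (quantile D q)) := by
  set S : Set ℝ≥0 := {t | 1 - q ≤ (D : Measure ℝ≥0).real (Set.Iic t)}
  have nonempty : S.Nonempty := by
    have tendsto_one : Tendsto (fun t ↦ (D : Measure ℝ≥0).real (Set.Iic t)) atTop (𝓝 1) := by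
      simpa [measureReal_def, Function.comp_def] using
        (ENNReal.tendsto_toReal (measure_ne_top _ _)).comp
          (tendsto_measure_Iic_atTop (D : Measure ℝ≥0))
    exact (tendsto_one.eventually (eventually_ge_nhds (by linarith))).exists
  have ge_of_gt : ∀ t > sInf S, ENNReal.ofReal (1 - q) ≤ (D : Measure ℝ≥0) (Set.Iic t) := by
    intro t ht
    obtain ⟨s, hs, hst⟩ := exists_lt_of_csInf_lt nonempty ht
    exact (ENNReal.ofReal_le_iff_le_toReal (measure_ne_top _ _)).2
      (hs.trans (measureReal_mono (Set.Iic_subset_Iic.2 hst.le)))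
  have right_continuous : Tendsto (fun t ↦ (D : Measure ℝ≥0) (Set.Iic t)) (𝓝[>] sInf S)
      (𝓝 ((D : Measure ℝ≥0) (Set.Iic (sInf S)))) := by
    have iInter_eq : ⋂ t > sInf S, Set.Iic t = Set.Iic (sInf S) := by
      ext x
      simpa using ⟨le_of_forall_gt_imp_ge_of_dense, fun hx t ht ↦ hx.trans ht.le⟩
    rw [← iInter_eq]
    exact tendsto_measure_biInter_gt (fun _ _ ↦ nullMeasurableSet_Iic)
      (fun _ _ _ hst ↦ Set.Iic_subset_Iic.2 hst) ⟨sInf S + 1, by simp, measure_ne_top _ _⟩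
  exact (ENNReal.ofReal_le_iff_le_toReal (measure_ne_top _ _)).1
    (ge_of_tendsto right_continuous (eventually_mem_nhdsWithin.mono ge_of_gt))

lemma quantile_le_iff (hq : 0 < q) {t : ℝ≥0} :
    quantile D q ≤ t ↔ 1 - q ≤ (D : Measure ℝ≥0).real (Set.Iic t) :=
  ⟨fun h ↦ (one_sub_le_real_Iic_quantile D hq).trans (measureReal_mono (Set.Iic_subset_Iic.2 h)),
    fun h ↦ csInf_le (OrderBot.bddBelow _) h⟩

lemma antitoneOn_quantile (D : Dist) : AntitoneOn (quantile D) (Set.Ioi 0) := fun _ hq _ hr hqr ↦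
  (quantile_le_iff hr).2 ((sub_le_sub_left hqr 1).trans (one_sub_le_real_Iic_quantile D hq))

lemma aemeasurable_quantile (D : Dist) :
    AEMeasurable (quantile D) (volume.restrict (Set.Ioc 0 1)) :=
  aemeasurable_restrict_of_antitoneOn measurableSet_Ioc
    ((antitoneOn_quantile D).mono Set.Ioc_subset_Ioi_self)

lemma map_quantile (D : Dist) : (volume.restrict (Set.Ioc 0 1)).map (quantile D) = D := by
  have : IsFiniteMeasure ((volume.restrict (Set.Ioc 0 1)).map (quantile D)) := inferInstance
  refine Measure.ext_of_Iic _ _ fun t ↦ ?_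
  set u := (D : Measure ℝ≥0).real (Set.Iic t) with hu
  have u_le_one : u ≤ 1 := measureReal_le_one
  have volume_eq : ENNReal.ofReal (1 - (1 - u)) = (D : Measure ℝ≥0) (Set.Iic t) := by
    rw [sub_sub_cancel, hu, ofReal_measureReal]
  rw [Measure.map_apply_of_aemeasurable (aemeasurable_quantile D) measurableSet_Iic,
    Measure.restrict_apply' measurableSet_Ioc, ← volume_eq]
  refine le_antisymm ?_ ?_
  · rw [← Real.volume_Icc]
    exact measure_mono fun q ⟨hqt, hq⟩ ↦ ⟨by linarith [(quantile_le_iff hq.1).1 hqt], hq.2⟩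
  · rw [← Real.volume_Ioc]
    refine measure_mono fun q hq ↦ ?_
    have q_pos : 0 < q := by linarith [hq.1]
    exact ⟨(quantile_le_iff q_pos).2 (by linarith [hq.1]), q_pos, hq.2⟩

lemma lintegral_comp_quantile (D : Dist) {f : ℝ≥0 → ℝ≥0∞} (hf : Measurable f) :
    ∫⁻ q in Set.Icc 0 1, f (quantile D q) = ∫⁻ v, f v ∂(D : Measure ℝ≥0) := by
  rw [setLIntegral_congr Ioc_ae_eq_Icc.symm, ← map_quantile D,
    lintegral_map' hf.aemeasurable (aemeasurable_quantile D)]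

end Quantile

section Scale

/-- The distribution of `c * v` for `v ∼ D`. -/
def scale (c : ℝ≥0) (D : Dist) : Dist :=
  D.map (f := (c * ·)) (by fun_prop)

lemma coe_scale (c : ℝ≥0) (D : Dist) :
    (scale c D : Measure ℝ≥0) = (D : Measure ℝ≥0).map (c * ·) := rfl

lemma mean_scale (c : ℝ≥0) (D : Dist) : mean (scale c D) = c * mean D := by
  rw [mean, coe_scale, lintegral_map (by fun_prop) (by fun_prop), mean,
    ← lintegral_const_mul _ (by fun_prop)]
  simp only [ENNReal.coe_mul]

lemma quantile_scale {c : ℝ≥0} (hc : 0 < c) (D : Dist) (q : ℝ) :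
    quantile (scale c D) q = c * quantile D q := by
  set S : Set ℝ≥0 := {t | 1 - q ≤ (D : Measure ℝ≥0).real (Set.Iic t)} with hS
  have setOf_eq_image :
      {t | 1 - q ≤ (scale c D : Measure ℝ≥0).real (Set.Iic t)} = OrderIso.mulLeft₀ c hc '' S := by
    ext t
    rw [OrderIso.image_eq_preimage_symm]
    have preimage_Iic : (c * ·) ⁻¹' Set.Iic t = Set.Iic (c⁻¹ * t) := by
      ext x
      exact (le_inv_mul_iff₀ hc).symm
    have symm_apply : (OrderIso.mulLeft₀ c hc).symm t = c⁻¹ * t := rfl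
    simp only [coe_scale, map_measureReal_apply (measurable_const_mul c) measurableSet_Iic,
      preimage_Iic, Set.mem_preimage, symm_apply, hS, Set.mem_ofPred_eq]
  rw [quantile, setOf_eq_image]
  rcases S.eq_empty_or_nonempty with hS_empty | hS_nonempty
  · have quantile_eq : quantile D q = sInf S := rfl
    simp [quantile_eq, hS_empty]
  · exact ((OrderIso.mulLeft₀ c hc).map_csInf' hS_nonempty (OrderBot.bddBelow S)).symm

end Scale

section Mechanism

variable {n : ℕ} {𝓕 : Fin n → Set Dist}

instance isProbabilityMeasure_joint (F : Profile 𝓕) : IsProbabilityMeasure (joint F) :=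
  inferInstanceAs (IsProbabilityMeasure (Measure.pi _))

lemma secondHighest_le_highest (v : Fin n → ℝ≥0) : secondHighest v ≤ highest v :=
  Finset.sup_le fun ij _ ↦ (min_le_left _ _).trans (Finset.le_sup (Finset.mem_univ ij.1))

lemma SPA_le_WEL (F : Profile 𝓕) : SPA F ≤ WEL F :=
  lintegral_mono fun v ↦ ENNReal.coe_le_coe.2 (secondHighest_le_highest v)

lemma WEL_le_sum_mean (F : Profile 𝓕) : WEL F ≤ ∑ i, mean (F i) := by
  have lintegral_eval (i : Fin n) : ∫⁻ v, (v i : ℝ≥0∞) ∂joint F = mean (F i) :=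
    (measurePreserving_eval (fun i ↦ ((F i : Dist) : Measure ℝ≥0)) i).lintegral_comp
      measurable_coe_nnreal_ennreal
  calc WEL F ≤ ∫⁻ v, ∑ i, (v i : ℝ≥0∞) ∂joint F := by
        refine lintegral_mono fun v ↦ ?_
        have highest_le : highest v ≤ ∑ i, v i :=
          Finset.sup_le fun i hi ↦ Finset.single_le_sum (f := v) (fun _ _ ↦ zero_le) hi
        rwa [← ENNReal.ofNNReal_finsetSum, ENNReal.coe_le_coe]
    _ = ∑ i, mean (F i) := by
        rw [lintegral_finsetSum _ fun i _ ↦ by fun_prop]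
        simp only [lintegral_eval]

namespace Mechanism

variable (M : Mechanism 𝓕)

lemma expectedValue_scale (i : Fin n) (B : Profile 𝓕) {c : ℝ≥0} (hc : 0 < c) (D : Dist) :
    M.expectedValue i B (scale c D) = c * M.expectedValue i B D := by
  simp only [expectedValue, quantile_scale hc, ENNReal.coe_mul, mul_left_comm _ (c : ℝ≥0∞)]
  simp only [lintegral_const_mul' _ _ ENNReal.coe_ne_top]

lemma expectedValue_le_mean (i : Fin n) (B : Profile 𝓕) (D : Dist) :
    M.expectedValue i B D ≤ mean D := by
  calc M.expectedValue i B D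
      ≤ ∫⁻ q in Set.Icc (0 : ℝ) 1, ∫⁻ _, (quantile D q : ℝ≥0∞) ∂joint B := by
        refine lintegral_mono fun q ↦ lintegral_mono fun b ↦ mul_le_of_le_one_left' ?_
        exact ENNReal.coe_le_one_iff.2 (M.alloc_le_one ..)
    _ = mean D := by
        simpa [mean] using lintegral_comp_quantile D measurable_coe_nnreal_ennreal

lemma measurable_alloc_mul (i : Fin n) (F : Profile 𝓕) :
    Measurable fun b ↦ (M.alloc i b F : ℝ≥0∞) * b i :=
  (M.measurable_alloc i F).coe_nnreal_ennreal.mul (by fun_prop)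

lemma expectedValue_self (i : Fin n) (F : Profile 𝓕) :
    M.expectedValue i F (F i) = ∫⁻ b, (M.alloc i b F : ℝ≥0∞) * b i ∂joint F := by
  have measurable_update_value : Measurable fun z : (Fin n → ℝ≥0) × ℝ≥0 ↦
      (M.alloc i (Function.update z.1 i z.2) F : ℝ≥0∞) * z.2 :=
    ((M.measurable_alloc i F).comp measurable_update').coe_nnreal_ennreal.mul (by fun_prop)
  calc M.expectedValue i F (F i)
      = ∫⁻ v, ∫⁻ b, (M.alloc i (Function.update b i v) F : ℝ≥0∞) * v ∂joint F
          ∂((F i : Dist) : Measure ℝ≥0) :=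
        lintegral_comp_quantile _ measurable_update_value.lintegral_prod_left'
    _ = ∫⁻ z, (M.alloc i (Function.update z.1 i z.2) F : ℝ≥0∞) * z.2
          ∂(joint F).prod ((F i : Dist) : Measure ℝ≥0) :=
        (lintegral_prod_symm' _ measurable_update_value).symm
    _ = ∫⁻ b, (M.alloc i b F : ℝ≥0∞) * b i ∂joint F := by
        simpa [joint] using (measurePreserving_update
          (fun j ↦ ((F j : Dist) : Measure ℝ≥0)) i).lintegral_comp (M.measurable_alloc_mul i F)

variable {M}

lemma Feasible.sum_expectedValue_le_WEL (hM : M.Feasible) (F : Profile 𝓕) :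
    ∑ i, M.expectedValue i F (F i) ≤ WEL F := by
  simp only [expectedValue_self]
  rw [← lintegral_finsetSum _ fun i _ ↦ M.measurable_alloc_mul i F]
  refine lintegral_mono fun b ↦ ?_
  calc ∑ i, (M.alloc i b F : ℝ≥0∞) * b i ≤ ∑ i, (M.alloc i b F : ℝ≥0∞) * highest b := by
        gcongr with i
        exact Finset.le_sup (f := b) (Finset.mem_univ i)
    _ = (∑ i, (M.alloc i b F : ℝ≥0∞)) * highest b := (Finset.sum_mul ..).symm
    _ ≤ highest b := mul_le_of_le_one_left' (by exact_mod_cast hM b F)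

lemma utility_eq_coe {i : Fin n} {B : Profile 𝓕} {D : Dist} (h : M.expectedValue i B D ≠ ⊤) :
    M.utility i B D = ((M.expectedValue i B D).toReal - M.pay i B : ℝ) := by
  rw [utility, EReal.coe_sub, EReal.coe_ennreal_toReal h]

lemma ExAnteIR.pay_le (hM : M.ExAnteIR) {F : Profile 𝓕} {i : Fin n}
    (h : M.expectedValue i F (F i) ≠ ⊤) : M.pay i F ≤ (M.expectedValue i F (F i)).toReal := by
  have := hM F i
  rwa [utility_eq_coe h, EReal.coe_nonneg, sub_nonneg] at this

lemma Valid.rev_le_WEL (hM : M.Valid) {F : Profile 𝓕} (hF : WEL F ≠ ⊤) :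
    M.rev F ≤ (WEL F).toReal := by
  have sum_le := hM.feasible.sum_expectedValue_le_WEL F
  have ne_top (i : Fin n) : M.expectedValue i F (F i) ≠ ⊤ :=
    ENNReal.sum_ne_top.1 (ne_top_of_le_ne_top hF sum_le) i (Finset.mem_univ i)
  calc M.rev F ≤ ∑ i, (M.expectedValue i F (F i)).toReal :=
        Finset.sum_le_sum fun i _ ↦ hM.exAnteIR.pay_le (ne_top i)
    _ = (∑ i, M.expectedValue i F (F i)).toReal :=
        (ENNReal.toReal_sum fun i _ ↦ ne_top i).symm
    _ ≤ (WEL F).toReal := ENNReal.toReal_mono hF sum_le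

end Mechanism

end Mechanism

section ScalePrior

/-- The geometric distribution truncated at `m`: the law of an exponent `k ≤ m` for which the scale
`2 ^ k` is at least `2 ^ j` with probability `2⁻ʲ`, for every `j ≤ m`. -/
def scalePrior (m : ℕ) : Measure (Fin (m + 1)) :=
  ∑ k : Fin m, (1 / 2 : ℝ≥0) ^ (k + 1 : ℕ) • Measure.dirac k.castSucc +
    (1 / 2 : ℝ≥0) ^ m • Measure.dirac (Fin.last m)

instance isFiniteMeasure_scalePrior (m : ℕ) : IsFiniteMeasure (scalePrior m) := by
  unfold scalePrior
  infer_instance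

lemma integral_scalePrior (m : ℕ) (f : ℕ → ℝ) :
    ∫ k, f k ∂scalePrior m =
      ∑ k ∈ Finset.range m, (1 / 2) ^ (k + 1) * f k + (1 / 2) ^ m * f m := by
  rw [scalePrior, integral_add_measure .of_finite .of_finite,
    integral_finsetSum_measure fun _ _ ↦ .of_finite]
  simp [integral_smul_nnreal_measure, NNReal.smul_def, Finset.sum_range]

instance isProbabilityMeasure_scalePrior (m : ℕ) : IsProbabilityMeasure (scalePrior m) := by
  have sum_add_eq_one :
      ∑ k ∈ Finset.range m, (1 / 2 : ℝ) ^ (k + 1) * 1 + (1 / 2) ^ m * 1 = 1 := by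
    induction m with
    | zero => simp
    | succ m ih =>
      rw [Finset.sum_range_succ, pow_succ _ m]
      linarith
  rw [← integral_scalePrior m fun _ ↦ 1, integral_const, smul_eq_mul, mul_one] at sum_add_eq_one
  exact ⟨by simpa [measureReal_def, ENNReal.toReal_eq_one_iff] using sum_add_eq_one⟩

lemma integral_two_pow_scalePrior (m : ℕ) :
    ∫ k, (2 : ℝ) ^ (k : ℕ) ∂scalePrior m = m / 2 + 1 := by
  have cancel (k : ℕ) : (1 / 2 : ℝ) ^ k * 2 ^ k = 1 := by
    rw [← mul_pow, one_div_mul_cancel two_ne_zero, one_pow]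
  simp only [integral_scalePrior m (2 ^ ·), pow_succ, mul_right_comm _ (1 / 2 : ℝ), cancel,
    Finset.sum_const, Finset.card_range, nsmul_eq_mul]
  ring

lemma integral_sq_two_pow_scalePrior_le (m : ℕ) :
    ∫ k, ((2 : ℝ) ^ (k : ℕ)) ^ 2 ∂scalePrior m ≤ 3 / 2 * 2 ^ m := by
  have cancel (k : ℕ) : (1 / 2 : ℝ) ^ k * (2 ^ k) ^ 2 = 2 ^ k := by
    rw [sq, ← mul_assoc, ← mul_pow, one_div_mul_cancel two_ne_zero, one_pow, one_mul]
  simp only [integral_scalePrior m fun k ↦ (2 ^ k) ^ 2, pow_succ (1 / 2 : ℝ),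
    mul_right_comm _ (1 / 2 : ℝ), cancel, ← Finset.sum_mul, geom_sum_eq (by norm_num : (2 : ℝ) ≠ 1)]
  linarith

-- Weighting the `k`-th incentive constraint by `2⁻⁽ᵏ⁺¹⁾` makes their sum telescope.
lemma integral_scalePrior_le (m : ℕ) {y p : ℕ → ℝ} (h_zero : p 0 ≤ y 0)
    (h_succ : ∀ k < m, 2 ^ (k + 1) * y k - p k ≤ 2 ^ (k + 1) * y (k + 1) - p (k + 1)) :
    ∫ k, p k ∂scalePrior m ≤ y m := by
  have partial_le (k : ℕ) (hk : k ≤ m) :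
      ∑ j ∈ Finset.range k, (1 / 2) ^ (j + 1) * p j + (1 / 2) ^ k * p k ≤ y k := by
    induction k with
    | zero => simpa using h_zero
    | succ k ih =>
      have weighted := mul_le_mul_of_nonneg_left (h_succ k hk)
        (by positivity : (0 : ℝ) ≤ (1 / 2) ^ (k + 1))
      have cancel : (1 / 2 : ℝ) ^ (k + 1) * 2 ^ (k + 1) = 1 := by
        rw [← mul_pow, one_div_mul_cancel two_ne_zero, one_pow]
      rw [mul_sub, mul_sub, ← mul_assoc, ← mul_assoc, cancel] at weighted
      rw [Finset.sum_range_succ]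
      have := ih (Nat.le_of_succ_le hk)
      rw [pow_succ _ k] at weighted ⊢
      linarith
  rw [integral_scalePrior]
  exact partial_le m le_rfl

end ScalePrior

section RandomScales

variable {n : ℕ} {𝓕 : Fin n → Set Dist} {M : Mechanism 𝓕}

lemma Mechanism.Valid.integral_pay_update_scale_le (hM : M.Valid) (i : Fin n) (B : Profile 𝓕)
    {D : Dist} (hD : mean D ≠ ⊤) (h : ∀ c, scale c D ∈ 𝓕 i) (m : ℕ) :
    ∫ k, M.pay i (Function.update B i ⟨scale (2 ^ (k : ℕ)) D, h _⟩) ∂scalePrior m ≤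
      (mean D).toReal := by
  let G (k : ℕ) : Profile 𝓕 := Function.update B i ⟨scale (2 ^ k) D, h _⟩
  let y (k : ℕ) : ℝ := (M.expectedValue i (G k) D).toReal
  have expectedValue_eq (j k : ℕ) : M.expectedValue i (G j) (scale (2 ^ k) D) =
      ((2 ^ k : ℝ≥0) : ℝ≥0∞) * M.expectedValue i (G j) D :=
    M.expectedValue_scale i (G j) (by positivity) D
  have expectedValue_ne_top (j : ℕ) : M.expectedValue i (G j) D ≠ ⊤ :=
    ne_top_of_le_ne_top hD (M.expectedValue_le_mean i (G j) D)
  have utility_eq (j k : ℕ) :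
      M.utility i (G j) (scale (2 ^ k) D) = (2 ^ k * y j - M.pay i (G j) : ℝ) := by
    rw [Mechanism.utility_eq_coe, expectedValue_eq, ENNReal.toReal_mul]
    · simp [y]
    · rw [expectedValue_eq]
      exact ENNReal.mul_ne_top ENNReal.coe_ne_top (expectedValue_ne_top j)
  have G_self (k : ℕ) : (G k i : Dist) = scale (2 ^ k) D := by simp [G]
  have update_G (k : ℕ) : Function.update (G k) i ⟨scale (2 ^ (k + 1)) D, h _⟩ = G (k + 1) := by
    simp [G]
  have rational : M.pay i (G 0) ≤ y 0 := by
    have := hM.exAnteIR (G 0) i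
    rwa [G_self, utility_eq, EReal.coe_nonneg, pow_zero, one_mul, sub_nonneg] at this
  have compatible (k : ℕ) : 2 ^ (k + 1) * y k - M.pay i (G k) ≤
      2 ^ (k + 1) * y (k + 1) - M.pay i (G (k + 1)) := by
    have := hM.exAnteIC i ⟨scale (2 ^ (k + 1)) D, h _⟩ (G k)
    rwa [update_G, utility_eq, utility_eq, EReal.coe_le_coe_iff] at this
  calc ∫ k : Fin (m + 1), M.pay i (G k) ∂scalePrior m
      ≤ y m := integral_scalePrior_le m rational fun k _ ↦ compatible k
    _ ≤ (mean D).toReal := ENNReal.toReal_mono hD (M.expectedValue_le_mean i (G m) D)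

/-- The instance in which the values of buyer `i` are distributed as `c i` times a draw from the
common distribution `D`. -/
def scaledProfile {D : Dist} (h : ∀ i c, scale c D ∈ 𝓕 i) (c : Fin n → ℝ≥0) : Profile 𝓕 :=
  fun i ↦ ⟨scale (c i) D, h i _⟩

variable {D : Dist} (h : ∀ i c, scale c D ∈ 𝓕 i)

lemma scaledProfile_two_pow_update {m : ℕ} (t : Fin n → Fin (m + 1)) (i : Fin n)
    (k : Fin (m + 1)) :
    scaledProfile h (fun j ↦ 2 ^ (Function.update t i k j : ℕ)) =
      Function.update (scaledProfile h fun j ↦ 2 ^ (t j : ℕ)) i ⟨scale (2 ^ (k : ℕ)) D, h i _⟩ := by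
  ext1 j
  rcases eq_or_ne j i with rfl | hj
  · simp [scaledProfile]
  · simp [scaledProfile, hj]

lemma WEL_scaledProfile_lt_top (hD : mean D ≠ ⊤) (c : Fin n → ℝ≥0) :
    WEL (scaledProfile h c) < ⊤ := by
  refine (WEL_le_sum_mean _).trans_lt (ENNReal.sum_lt_top.2 fun i _ ↦ ?_)
  rw [scaledProfile, mean_scale]
  exact ENNReal.mul_lt_top ENNReal.coe_lt_top hD.lt_top

lemma Mechanism.Valid.integral_rev_scaledProfile_le (hM : M.Valid) (hD : mean D ≠ ⊤) (m : ℕ) :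
    ∫ t, M.rev (scaledProfile h fun i ↦ 2 ^ (t i : ℕ))
      ∂Measure.pi (fun _ : Fin n ↦ scalePrior m) ≤ n * (mean D).toReal := by
  set μ := Measure.pi fun _ : Fin n ↦ scalePrior m
  have integral_pay_le (i : Fin n) :
      ∫ t, M.pay i (scaledProfile h fun j ↦ 2 ^ (t j : ℕ)) ∂μ ≤ (mean D).toReal := by
    calc ∫ t, M.pay i (scaledProfile h fun j ↦ 2 ^ (t j : ℕ)) ∂μ
        = ∫ t : Fin n → Fin (m + 1), M.pay i (scaledProfile h fun j ↦ 2 ^ (t j : ℕ))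
            ∂(μ.prod (scalePrior m)).map (fun z ↦ Function.update z.1 i z.2) := by
          rw [(measurePreserving_update (fun _ : Fin n ↦ scalePrior m) i).map_eq]
      _ = ∫ t, ∫ k, M.pay i (scaledProfile h fun j ↦ 2 ^ (Function.update t i k j : ℕ))
            ∂scalePrior m ∂μ := by
          rw [integral_map measurable_update'.aemeasurable .of_discrete,
            integral_prod _ .of_finite]
      _ ≤ ∫ _, (mean D).toReal ∂μ := by
          refine integral_mono .of_finite .of_finite fun t ↦ ?_
          simp only [scaledProfile_two_pow_update]
          exact hM.integral_pay_update_scale_le i _ hD (h i) m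
      _ = (mean D).toReal := by simp
  calc ∫ t, M.rev (scaledProfile h fun i ↦ 2 ^ (t i : ℕ)) ∂μ
      = ∑ i, ∫ t, M.pay i (scaledProfile h fun i ↦ 2 ^ (t i : ℕ)) ∂μ :=
        integral_finsetSum _ fun _ _ ↦ .of_finite
    _ ≤ ∑ _ : Fin n, (mean D).toReal := Finset.sum_le_sum fun i _ ↦ integral_pay_le i
    _ = n * (mean D).toReal := by simp

lemma Mechanism.Valid.exists_rev_scaledProfile_le_min (hM : M.Valid) (hD : mean D ≠ ⊤) (m : ℕ)
    {r c : ℝ} (hc : 0 < c)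
    (hrc : n * (mean D).toReal ≤ r * (n * (m / 2 + 1)) -
      (r ^ 2 * (n * (3 / 2 * 2 ^ m)) + (r * (n * (m / 2 + 1))) ^ 2) / (4 * c)) :
    ∃ t : Fin n → ℕ, M.rev (scaledProfile h fun i ↦ 2 ^ t i) ≤
      min (r * ∑ i, (2 : ℝ) ^ t i) c := by
  set μ := Measure.pi fun _ : Fin n ↦ scalePrior m
  set Y : (Fin n → Fin (m + 1)) → ℝ := fun t ↦ r * ∑ i, (2 : ℝ) ^ (t i : ℕ)
  have mean_Y : μ[Y] = r * (n * (m / 2 + 1)) := by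
    rw [integral_const_mul,
      integral_sum_comp_eval (X := fun k : Fin (m + 1) ↦ (2 : ℝ) ^ (k : ℕ)) .of_finite,
      integral_two_pow_scalePrior, Fintype.card_fin]
  have variance_Y : Var[Y; μ] ≤ r ^ 2 * (n * (3 / 2 * 2 ^ m)) := by
    rw [variance_const_mul]
    gcongr
    refine (variance_sum_comp_eval_le
      (X := fun k : Fin (m + 1) ↦ (2 : ℝ) ^ (k : ℕ)) .of_discrete).trans ?_
    rw [Fintype.card_fin]
    gcongr
    exact integral_sq_two_pow_scalePrior_le m
  have rev_le_benchmark :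
      ∫ t, M.rev (scaledProfile h fun i ↦ 2 ^ (t i : ℕ)) ∂μ ≤ ∫ t, min (Y t) c ∂μ := by
    calc ∫ t, M.rev (scaledProfile h fun i ↦ 2 ^ (t i : ℕ)) ∂μ
        ≤ n * (mean D).toReal := hM.integral_rev_scaledProfile_le h hD m
      _ ≤ r * (n * (m / 2 + 1)) -
            (r ^ 2 * (n * (3 / 2 * 2 ^ m)) + (r * (n * (m / 2 + 1))) ^ 2) / (4 * c) := hrc
      _ ≤ μ[Y] - (Var[Y; μ] + μ[Y] ^ 2) / (4 * c) := by
          rw [mean_Y]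
          gcongr
      _ ≤ ∫ t, min (Y t) c ∂μ := integral_sub_variance_div_le_integral_min .of_discrete hc
  obtain ⟨t, ht⟩ := exists_le_integral (μ := μ)
    (f := fun t ↦ M.rev (scaledProfile h fun i ↦ 2 ^ (t i : ℕ)) - min (Y t) c) .of_finite
  rw [integral_sub .of_finite .of_finite] at ht
  exact ⟨fun i ↦ t i, by linarith⟩

end RandomScales

section ActiveBox

variable {n : ℕ} {a : Fin n → ℝ≥0}

/-- The value vectors in which the buyers `i ∈ s` are active, with a value of at least `a i`, and
all other buyers have value `0`. -/
def activeBox (a : Fin n → ℝ≥0) (s : Finset (Fin n)) : Set (Fin n → ℝ≥0) :=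
  Set.univ.pi fun i ↦ if i ∈ s then Set.Ici (a i) else {0}

lemma measurableSet_activeBox (s : Finset (Fin n)) : MeasurableSet (activeBox a s) := by
  refine .univ_pi fun i ↦ ?_
  split_ifs
  exacts [measurableSet_Ici, measurableSet_singleton 0]

lemma le_of_mem_activeBox {s : Finset (Fin n)} {v : Fin n → ℝ≥0} (hv : v ∈ activeBox a s)
    {i : Fin n} (hi : i ∈ s) : a i ≤ v i := by
  simpa [hi] using hv i (Set.mem_univ i)

lemma mem_iff_pos_of_mem_activeBox (ha : ∀ i, 0 < a i) {s : Finset (Fin n)} {v : Fin n → ℝ≥0}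
    (hv : v ∈ activeBox a s) {i : Fin n} : i ∈ s ↔ 0 < v i := by
  refine ⟨fun hi ↦ (ha i).trans_le (le_of_mem_activeBox hv hi), fun hpos ↦ ?_⟩
  by_contra hi
  exact hpos.ne' (by simpa [hi] using hv i (Set.mem_univ i))

lemma pairwise_disjoint_activeBox (ha : ∀ i, 0 < a i) :
    Pairwise (Function.onFun Disjoint (activeBox a)) := by
  refine fun s t hst ↦ Set.disjoint_left.2 fun v hvs hvt ↦ hst ?_
  ext i
  rw [mem_iff_pos_of_mem_activeBox ha hvs, mem_iff_pos_of_mem_activeBox ha hvt]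

variable {𝓕 : Fin n → Set Dist} {F : Profile 𝓕} {p z : ℝ≥0∞}

lemma le_joint_activeBox (hp : ∀ i, p ≤ (F i : Measure ℝ≥0) (Set.Ici (a i)))
    (hz : ∀ i, z ≤ (F i : Measure ℝ≥0) {0}) (s : Finset (Fin n)) :
    p ^ s.card * z ^ (n - s.card) ≤ joint F (activeBox a s) := by
  calc p ^ s.card * z ^ (n - s.card) = ∏ i, if i ∈ s then p else z := by
        rw [Finset.prod_ite, Finset.prod_const, Finset.prod_const, Finset.filter_mem_eq_inter,
          Finset.univ_inter, Finset.filter_notMem_eq_sdiff, ← Finset.compl_eq_univ_sdiff,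
          Finset.card_compl, Fintype.card_fin]
    _ ≤ ∏ i, ((F i : Dist) : Measure ℝ≥0) (if i ∈ s then Set.Ici (a i) else {0}) := by
        gcongr with i
        split_ifs
        exacts [hp i, hz i]
    _ = joint F (activeBox a s) := (Measure.pi_pi _ _).symm

lemma sum_mul_le_lintegral_joint (ha : ∀ i, 0 < a i)
    (hp : ∀ i, p ≤ (F i : Measure ℝ≥0) (Set.Ici (a i))) (hz : ∀ i, z ≤ (F i : Measure ℝ≥0) {0})
    {S : Finset (Finset (Fin n))} {c : Finset (Fin n) → ℝ≥0∞} {f : (Fin n → ℝ≥0) → ℝ≥0∞}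
    (hf : ∀ s ∈ S, ∀ v ∈ activeBox a s, c s ≤ f v) :
    ∑ s ∈ S, c s * (p ^ s.card * z ^ (n - s.card)) ≤ ∫⁻ v, f v ∂joint F := by
  calc ∑ s ∈ S, c s * (p ^ s.card * z ^ (n - s.card))
      ≤ ∑ s ∈ S, ∫⁻ v in activeBox a s, f v ∂joint F := by
        refine Finset.sum_le_sum fun s hs ↦ ?_
        calc c s * (p ^ s.card * z ^ (n - s.card)) ≤ c s * joint F (activeBox a s) := by
              gcongr
              exact le_joint_activeBox hp hz s
          _ = ∫⁻ _ in activeBox a s, c s ∂joint F := (setLIntegral_const _ _).symm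
          _ ≤ ∫⁻ v in activeBox a s, f v ∂joint F :=
              setLIntegral_mono' (measurableSet_activeBox s) (hf s hs)
    _ = ∫⁻ v in ⋃ s ∈ S, activeBox a s, f v ∂joint F :=
        (lintegral_biUnion_finset (fun _ _ _ _ hst ↦ pairwise_disjoint_activeBox ha hst)
          (fun s _ ↦ measurableSet_activeBox s) f).symm
    _ ≤ ∫⁻ v, f v ∂joint F := setLIntegral_le_lintegral _ _

lemma sum_mul_le_WEL (ha : ∀ i, 0 < a i)
    (hp : ∀ i, p ≤ (F i : Measure ℝ≥0) (Set.Ici (a i))) (hz : ∀ i, z ≤ (F i : Measure ℝ≥0) {0}) :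
    (∑ i, (a i : ℝ≥0∞)) * (p * z ^ (n - 1)) ≤ WEL F := by
  have le_highest : ∀ s ∈ Finset.univ.powersetCard 1, ∀ v ∈ activeBox a s,
      ∑ i ∈ s, (a i : ℝ≥0∞) ≤ highest v := by
    intro s hs v hv
    obtain ⟨i, rfl⟩ := Finset.card_eq_one.1 (Finset.mem_powersetCard_univ.1 hs)
    rw [Finset.sum_singleton, ENNReal.coe_le_coe]
    exact (le_of_mem_activeBox hv (Finset.mem_singleton_self i)).trans
      (Finset.le_sup (Finset.mem_univ i))
  simpa [WEL, Finset.powersetCard_one, Finset.sum_mul] using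
    sum_mul_le_lintegral_joint ha hp hz le_highest

lemma choose_two_mul_le_SPA {c : ℝ≥0} (hc : 0 < c) (hca : ∀ i, c ≤ a i)
    (hp : ∀ i, p ≤ (F i : Measure ℝ≥0) (Set.Ici (a i))) (hz : ∀ i, z ≤ (F i : Measure ℝ≥0) {0}) :
    n.choose 2 * (c * (p ^ 2 * z ^ (n - 2))) ≤ SPA F := by
  have le_secondHighest : ∀ s ∈ Finset.univ.powersetCard 2, ∀ v ∈ activeBox a s,
      (c : ℝ≥0∞) ≤ secondHighest v := by
    intro s hs v hv
    obtain ⟨i, j, hij, rfl⟩ := Finset.card_eq_two.1 (Finset.mem_powersetCard_univ.1 hs)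
    have c_le : c ≤ min (v i) (v j) :=
      le_min ((hca i).trans (le_of_mem_activeBox hv (by simp)))
        ((hca j).trans (le_of_mem_activeBox hv (by simp)))
    exact ENNReal.coe_le_coe.2 (c_le.trans (Finset.le_sup (f := fun x ↦ min (v x.1) (v x.2))
      (b := (i, j)) (Finset.mem_offDiag.2 ⟨Finset.mem_univ i, Finset.mem_univ j, hij⟩)))
  calc (n.choose 2 : ℝ≥0∞) * (c * (p ^ 2 * z ^ (n - 2)))
      = ∑ s ∈ (Finset.univ : Finset (Fin n)).powersetCard 2,
          (c : ℝ≥0∞) * (p ^ s.card * z ^ (n - s.card)) := by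
        rw [Finset.sum_congr rfl fun s hs ↦ by rw [Finset.mem_powersetCard_univ.1 hs],
          Finset.sum_const, Finset.card_powersetCard, Finset.card_univ, Fintype.card_fin,
          nsmul_eq_mul]
    _ ≤ SPA F := sum_mul_le_lintegral_joint (fun i ↦ hc.trans_le (hca i)) hp hz le_secondHighest

end ActiveBox

section RareValue

/-- The distribution of a value that is `a` with probability `p` and `0` otherwise. -/
def twoPoint (p : unitInterval) (a : ℝ≥0) : Dist :=
  ⟨bernoulliMeasure a 0 p, inferInstance⟩

lemma coe_twoPoint (p : unitInterval) (a : ℝ≥0) :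
    (twoPoint p a : Measure ℝ≥0) = bernoulliMeasure a 0 p := rfl

lemma scale_twoPoint (c : ℝ≥0) (p : unitInterval) (a : ℝ≥0) :
    scale c (twoPoint p a) = twoPoint p (c * a) := by
  ext1
  rw [coe_scale, coe_twoPoint, coe_twoPoint, map_bernoulliMeasure' _ _ (measurable_const_mul c),
    mul_zero]

lemma twoPoint_pair (p : unitInterval) (a : ℝ≥0) : (twoPoint p a : Measure ℝ≥0) {0, a} = 1 := by
  simp [coe_twoPoint]

lemma mean_twoPoint (p : unitInterval) (a : ℝ≥0) :
    mean (twoPoint p a) = unitInterval.toNNReal p * a := by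
  rw [mean, coe_twoPoint, bernoulliMeasure_def, lintegral_add_measure, lintegral_smul_measure,
    lintegral_smul_measure, lintegral_dirac, lintegral_dirac, ENNReal.coe_zero, smul_zero, add_zero,
    ENNReal.smul_def, smul_eq_mul]

lemma toNNReal_le_twoPoint_Ici (p : unitInterval) (a : ℝ≥0) :
    unitInterval.toNNReal p ≤ (twoPoint p a : Measure ℝ≥0) (Set.Ici a) := by
  rw [coe_twoPoint, bernoulliMeasure_def, Measure.add_apply, Measure.smul_apply,
    Measure.dirac_apply_of_mem Set.self_mem_Ici, ENNReal.smul_def, smul_eq_mul, mul_one]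
  exact le_self_add

lemma toNNReal_symm_le_twoPoint_zero (p : unitInterval) (a : ℝ≥0) :
    unitInterval.toNNReal (unitInterval.symm p) ≤ (twoPoint p a : Measure ℝ≥0) {0} := by
  rw [coe_twoPoint, bernoulliMeasure_def, Measure.add_apply, Measure.smul_apply,
    Measure.smul_apply, Measure.dirac_apply_of_mem (Set.mem_singleton 0), ENNReal.smul_def _ 1,
    smul_eq_mul, mul_one]
  exact le_add_self

/-- The activity probability `1 / (2 * n)`, at which the expected number of active ones among `n`
buyers is `1 / 2`. -/
def rareProb (n : ℕ) : unitInterval :=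
  ⟨((2 * n : ℕ) : ℝ)⁻¹, by positivity, Nat.cast_inv_le_one _⟩

lemma toNNReal_rareProb (n : ℕ) : unitInterval.toNNReal (rareProb n) = (2 * n : ℝ≥0)⁻¹ := by
  ext
  simp [rareProb]

lemma half_le_symm_rareProb_pow {n l : ℕ} (hl : l ≤ n) :
    1 / 2 ≤ unitInterval.toNNReal (unitInterval.symm (rareProb n)) ^ l := by
  have l_mul_prob_le : (l : ℝ) * rareProb n ≤ 1 / 2 := by
    rw [rareProb, ← div_eq_mul_inv]
    refine div_le_of_le_mul₀ (by positivity) (by norm_num) ?_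
    push_cast
    have : (l : ℝ) ≤ n := by exact_mod_cast hl
    linarith
  rw [← NNReal.coe_le_coe, NNReal.coe_pow, unitInterval.coe_toNNReal, unitInterval.coe_symm_eq,
    sub_eq_add_neg]
  calc ((1 / 2 : ℝ≥0) : ℝ) ≤ 1 + l * -(rareProb n : ℝ) := by
        push_cast
        linarith
    _ ≤ (1 + -(rareProb n : ℝ)) ^ l :=
        one_add_mul_le_pow (by linarith [unitInterval.le_one (rareProb n)]) l

/-- The distribution of mean `1` under which each of `n` buyers is active, that is, has a nonzero
value, with probability `1 / (2 * n)`. -/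
def rareValue (n : ℕ) : Dist := twoPoint (rareProb n) (2 * n)

variable {n : ℕ} {𝓕 : Fin n → Set Dist} (h : ∀ i c, scale c (rareValue n) ∈ 𝓕 i)
  {c : Fin n → ℝ≥0}

lemma mean_rareValue (hn : n ≠ 0) : mean (rareValue n) = 1 := by
  rw [rareValue, mean_twoPoint, toNNReal_rareProb, ← ENNReal.coe_mul,
    inv_mul_cancel₀ (by positivity), ENNReal.coe_one]

lemma coe_scaledProfile_rareValue (c : Fin n → ℝ≥0) (i : Fin n) :
    (scaledProfile h c i : Dist) = twoPoint (rareProb n) (c i * (2 * n)) :=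
  scale_twoPoint ..

lemma toNNReal_rareProb_le_scaledProfile_Ici (c : Fin n → ℝ≥0) (i : Fin n) :
    unitInterval.toNNReal (rareProb n) ≤
      ((scaledProfile h c i : Dist) : Measure ℝ≥0) (Set.Ici (c i * (2 * n))) := by
  rw [coe_scaledProfile_rareValue]
  exact toNNReal_le_twoPoint_Ici _ _

lemma toNNReal_symm_rareProb_le_scaledProfile_zero (c : Fin n → ℝ≥0) (i : Fin n) :
    unitInterval.toNNReal (unitInterval.symm (rareProb n)) ≤
      ((scaledProfile h c i : Dist) : Measure ℝ≥0) {0} := by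
  rw [coe_scaledProfile_rareValue]
  exact toNNReal_symm_le_twoPoint_zero _ _

lemma half_sum_le_WEL_scaledProfile (hc : ∀ i, 0 < c i) :
    ((1 / 2 * ∑ i, c i : ℝ≥0) : ℝ≥0∞) ≤ WEL (scaledProfile h c) := by
  rcases eq_or_ne n 0 with rfl | hn
  · simp
  have active_le := sum_mul_le_WEL (a := fun i ↦ c i * (2 * n))
    (fun i ↦ mul_pos (hc i) (by positivity)) (toNNReal_rareProb_le_scaledProfile_Ici h c)
    (toNNReal_symm_rareProb_le_scaledProfile_zero h c)
  refine le_trans ?_ active_le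
  norm_cast
  push_cast
  rw [← Finset.sum_mul, toNNReal_rareProb, mul_assoc, mul_inv_cancel_left₀ (by positivity),
    mul_comm]
  gcongr
  exact half_le_symm_rareProb_pow (Nat.sub_le n 1)

lemma div_sixteen_le_SPA_scaledProfile (hn : 2 ≤ n) (hc : ∀ i, 1 ≤ c i) :
    ((n / 16 : ℝ≥0) : ℝ≥0∞) ≤ SPA (scaledProfile h c) := by
  have active_le := choose_two_mul_le_SPA (c := 2 * n) (a := fun i ↦ c i * (2 * n)) (by positivity)
    (fun i ↦ le_mul_of_one_le_left zero_le (hc i)) (toNNReal_rareProb_le_scaledProfile_Ici h c)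
    (toNNReal_symm_rareProb_le_scaledProfile_zero h c)
  have choose_ge : (n : ℝ≥0) * n / 4 ≤ n.choose 2 := by
    rw [← NNReal.coe_le_coe]
    push_cast
    rw [Nat.cast_choose_two]
    have : (2 : ℝ) ≤ n := by exact_mod_cast hn
    nlinarith
  refine le_trans ?_ active_le
  norm_cast
  push_cast
  calc (n : ℝ≥0) / 16 = n * n / 4 * (2 * n * ((2 * n : ℝ≥0)⁻¹ ^ 2 * (1 / 2))) := by
        field_simp
        norm_num
    _ ≤ _ := by
        rw [toNNReal_rareProb]
        gcongr
        exact half_le_symm_rareProb_pow (Nat.sub_le n 2)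

end RareValue

section Benchmark

variable {n : ℕ} {𝓕 : Fin n → Set Dist} {M : Mechanism 𝓕}

lemma highest_const (hn : n ≠ 0) (a : ℝ≥0) : highest (fun _ : Fin n ↦ a) = a :=
  have : NeZero n := ⟨hn⟩
  Finset.sup_const Finset.univ_nonempty a

lemma secondHighest_const (hn : 2 ≤ n) (a : ℝ≥0) : secondHighest (fun _ : Fin n ↦ a) = a := by
  have : Nontrivial (Fin n) := Fin.nontrivial_iff_two_le.2 hn
  rw [secondHighest, min_self]
  obtain ⟨i, j, hij⟩ := exists_pair_ne (Fin n)
  exact Finset.sup_const ⟨(i, j), by simpa using hij⟩ a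

lemma Mechanism.Valid.exists_rev_le_one (hM : M.Valid) (hn : 2 ≤ n)
    (h : ∀ i, twoPoint 1 1 ∈ 𝓕 i) : ∃ F : Profile 𝓕, SPA F = 1 ∧ WEL F = 1 ∧ M.rev F ≤ 1 := by
  let F : Profile 𝓕 := fun i ↦ ⟨twoPoint 1 1, h i⟩
  have joint_eq : joint F = Measure.dirac fun _ ↦ 1 := by
    simp only [joint, F, coe_twoPoint, bernoulliMeasure_one]
    exact pi_dirac _
  have WEL_eq : WEL F = 1 := by
    rw [WEL, joint_eq, lintegral_dirac, highest_const (by omega), ENNReal.coe_one]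
  have SPA_eq : SPA F = 1 := by
    rw [SPA, joint_eq, lintegral_dirac, secondHighest_const hn, ENNReal.coe_one]
  refine ⟨F, SPA_eq, WEL_eq, ?_⟩
  simpa [WEL_eq] using hM.rev_le_WEL (F := F) (by simp [WEL_eq])

lemma le_benchmark {N P r τ x : ℝ} (hN : 0 < N) (hP : 64 ≤ P) (hr : 0 ≤ r) (hr' : r ≤ 1 / 2)
    (hrτ : 4 ≤ r * τ) (hrτ' : r * τ ≤ 9 / 2) (hx : x ≤ P * N) :
    N ≤ r * (N * τ) -
      (r ^ 2 * (N * (3 / 2 * x)) + (r * (N * τ)) ^ 2) / (4 * (P * (N / 16))) := by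
  have : 0 < P := by linarith
  have variance_term : 6 * r ^ 2 * x / P ≤ 3 / 2 * N := by
    calc 6 * r ^ 2 * x / P ≤ 6 * r ^ 2 * (P * N) / P := by gcongr
      _ ≤ 6 * (1 / 2) ^ 2 * (P * N) / P := by gcongr
      _ = 3 / 2 * N := by field_simp; norm_num
  have mean_term : 4 * (r * τ) ^ 2 * N / P ≤ 81 / 64 * N := by
    calc 4 * (r * τ) ^ 2 * N / P ≤ 4 * (9 / 2) ^ 2 * N / 64 := by gcongr
      _ = 81 / 64 * N := by ring
  have expand : r * (N * τ) -
      (r ^ 2 * (N * (3 / 2 * x)) + (r * (N * τ)) ^ 2) / (4 * (P * (N / 16))) =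
      r * τ * N - 6 * r ^ 2 * x / P - 4 * (r * τ) ^ 2 * N / P := by
    field_simp
    ring
  rw [expand]
  nlinarith

lemma Mechanism.Valid.exists_rev_scaledProfile_rareValue_le (hM : M.Valid) (hn : 2 ≤ n)
    (h : ∀ i c, scale c (rareValue n) ∈ 𝓕 i) {K : ℝ} (hK : 6 ≤ K)
    (hS : 64 < K + Real.logb 2 n) :
    ∃ t : Fin n → ℕ, M.rev (scaledProfile h fun i ↦ 2 ^ t i) ≤
      min (32 / (K + Real.logb 2 n) * ∑ i, (2 : ℝ) ^ t i) (2 ^ K * (n / 16)) := by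
  set S := K + Real.logb 2 n with hS_def
  have n_pos : (0 : ℝ) < n := by positivity
  have S_pos : 0 < S := by linarith
  have mean_eq : mean (rareValue n) = 1 := mean_rareValue (by omega)
  set m := ⌊S / 4⌋₊
  have m_le : (m : ℝ) ≤ S / 4 := Nat.floor_le (by positivity)
  have lt_m_add_one : S / 4 < m + 1 := Nat.lt_floor_add_one _
  have two_pow_le : (2 : ℝ) ^ m ≤ 2 ^ K * n := by
    calc (2 : ℝ) ^ m = 2 ^ (m : ℝ) := (Real.rpow_natCast _ _).symm
      _ ≤ 2 ^ S := Real.rpow_le_rpow_of_exponent_le one_le_two (by linarith)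
      _ = 2 ^ K * n := by
        rw [hS_def, Real.rpow_add two_pos, Real.rpow_logb two_pos (by norm_num) n_pos]
  have le_two_rpow : (64 : ℝ) ≤ 2 ^ K := by
    calc (64 : ℝ) = 2 ^ (6 : ℝ) := by norm_num
      _ ≤ 2 ^ K := Real.rpow_le_rpow_of_exponent_le one_le_two hK
  refine hM.exists_rev_scaledProfile_le_min h (by simp [mean_eq]) m (by positivity) ?_
  rw [mean_eq, ENNReal.toReal_one, mul_one]
  refine le_benchmark n_pos le_two_rpow (by positivity) ?_ ?_ ?_ two_pow_le
  · rw [div_le_iff₀ S_pos]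
    linarith
  · rw [div_mul_eq_mul_div, le_div_iff₀ S_pos]
    linarith
  · rw [div_mul_eq_mul_div, div_le_iff₀ S_pos]
    linarith

lemma Mechanism.Valid.exists_rev_le_min_of_rareValue_mem (hM : M.Valid) (hn : 2 ≤ n)
    (h : ∀ i c, scale c (rareValue n) ∈ 𝓕 i) {K : ℝ} (hK : 6 ≤ K)
    (hS : 64 < K + Real.logb 2 n) :
    ∃ F : Profile 𝓕, 0 < SPA F ∧ WEL F < ⊤ ∧
      M.rev F ≤ min (64 / (K + Real.logb 2 n) * (WEL F).toReal) (2 ^ K * (SPA F).toReal) := by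
  obtain ⟨t, rev_le⟩ := hM.exists_rev_scaledProfile_rareValue_le hn h hK hS
  set F := scaledProfile h fun i ↦ 2 ^ t i
  have WEL_lt_top : WEL F < ⊤ :=
    WEL_scaledProfile_lt_top h (by simp [mean_rareValue (by omega : n ≠ 0)]) _
  have SPA_ge : ((n / 16 : ℝ≥0) : ℝ≥0∞) ≤ SPA F :=
    div_sixteen_le_SPA_scaledProfile h hn fun i ↦ one_le_pow₀ one_le_two
  have WEL_toReal_ge : 1 / 2 * ∑ i, (2 : ℝ) ^ t i ≤ (WEL F).toReal := by
    have := ENNReal.toReal_mono WEL_lt_top.ne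
      (half_sum_le_WEL_scaledProfile h (c := fun i ↦ 2 ^ t i) fun i ↦ by positivity)
    rw [ENNReal.coe_toReal] at this
    exact_mod_cast this
  have SPA_toReal_ge : (n / 16 : ℝ) ≤ (SPA F).toReal := by
    simpa using ENNReal.toReal_mono ((SPA_le_WEL F).trans_lt WEL_lt_top).ne SPA_ge
  have SPA_pos : 0 < SPA F := lt_of_lt_of_le (by positivity) SPA_ge
  refine ⟨F, SPA_pos, WEL_lt_top, rev_le.trans (min_le_min ?_ (by gcongr))⟩
  calc 32 / (K + Real.logb 2 n) * ∑ i, (2 : ℝ) ^ t i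
      = 64 / (K + Real.logb 2 n) * (1 / 2 * ∑ i, (2 : ℝ) ^ t i) := by ring
    _ ≤ 64 / (K + Real.logb 2 n) * (WEL F).toReal := by gcongr

lemma mean_lt_top_of_pair {D : Dist} {a : ℝ≥0} (h : (D : Measure ℝ≥0) {0, a} = 1) :
    mean D < ⊤ := by
  have ae_le : ∀ᵐ v : ℝ≥0 ∂(D : Measure ℝ≥0), (v : ℝ≥0∞) ≤ a := by
    have pair_mem_ae : ({0, a} : Set ℝ≥0) ∈ ae (D : Measure ℝ≥0) :=
      (mem_ae_iff_prob_eq_one (Set.toFinite _).measurableSet).2 h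
    filter_upwards [pair_mem_ae] with v hv
    rcases hv with rfl | rfl <;> simp
  calc mean D ≤ ∫⁻ _, (a : ℝ≥0∞) ∂(D : Measure ℝ≥0) := lintegral_mono_ae ae_le
    _ < ⊤ := by simp

end Benchmark

end DistReport

end

open DistReport in
theorem mainTheorem2_general (n : ℕ) (hn : 2 ≤ n) (K : ℝ) (hK : 6 ≤ K) (𝓕 : Fin n → Set Dist)
    (h𝓕 : ∀ i (a : NNReal), {D : Dist | (D : MeasureTheory.Measure NNReal) {0, a} = 1} ⊆ 𝓕 i)
    (M : Mechanism 𝓕) (hM : M.Valid) :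
    ∃ F : Profile 𝓕, 0 < SPA F ∧ WEL F < ⊤ ∧
      M.rev F ≤ min (64 / (K + Real.logb 2 n) * (WEL F).toReal) (2 ^ K * (SPA F).toReal) := by
  have twoPoint_mem (i : Fin n) (p : unitInterval) (a : NNReal) : twoPoint p a ∈ 𝓕 i :=
    h𝓕 i a (twoPoint_pair p a)
  have S_pos : 0 < K + Real.logb 2 n :=
    add_pos_of_pos_of_nonneg (by linarith) (Real.logb_nonneg one_lt_two (by norm_cast; omega))
  rcases le_or_gt (K + Real.logb 2 n) 64 with hS | hS
  · obtain ⟨F, hSPA, hWEL, hrev⟩ := hM.exists_rev_le_one hn fun i ↦ twoPoint_mem i 1 1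
    refine ⟨F, by simp [hSPA], by simp [hWEL], hrev.trans (le_min ?_ ?_)⟩
    · simpa [hWEL] using (one_le_div S_pos).2 hS
    · simpa [hSPA] using Real.one_le_rpow one_le_two (by linarith)
  · have rareValue_mem (i : Fin n) (c : NNReal) : scale c (rareValue n) ∈ 𝓕 i := by
      rw [rareValue, scale_twoPoint]
      exact twoPoint_mem ..
    exact hM.exists_rev_le_min_of_rareValue_mem hn rareValue_mem hK hS

theorem mainTheorem2 (n : ℕ) (hn : 2 ≤ n) (K : ℝ) (hK : 6 ≤ K)
    (𝓕 : Fin n → Set DistReport.Dist)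
    (h𝓕 : ∀ i, {D : DistReport.Dist | DistReport.mean D < ⊤} ⊆ 𝓕 i)
    (M : DistReport.Mechanism 𝓕) (hM : M.Valid) :
    ∃ F : DistReport.Profile 𝓕,
      0 < DistReport.SPA F ∧ DistReport.WEL F < ⊤ ∧
        M.rev F ≤ min (64 / (K + Real.logb 2 n) * (DistReport.WEL F).toReal)
          ((2 : ℝ) ^ K * (DistReport.SPA F).toReal) := by
  exact mainTheorem2_general n hn K hK 𝓕
    (fun i _ _ hD ↦ h𝓕 i (DistReport.mean_lt_top_of_pair hD)) M hM
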